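/- Let $K$ be a field and let $\Delta$ be a simplicial complex with vertex set $\{v_1,\dots,v_n\}$, that is, a collection of subsets of the vertex set, closed under taking subsets and containing all $\{v_i\}$. A facet is a maximal face, an edge is a face with two elements, and $\dim\Delta=\max\{|F|-1 : F\in\Delta\}$. A complex $\Gamma$ is a subcomplex of $\Delta$ if every facet of $\Gamma$ is a facet of $\Delta$. A facet $F$ of a complex is a leaf if it is the only facet, or if there is a facet $G\ne F$ such that $F\cap H\subseteq F\cap G$ for all facets $H\neq F$. A complex is connected if any two of its facets are joined by a sequence of facets in which consecutive ones intersect. It is a tree if it is connected and each of its nonempty subcomplexes has a leaf, and a forest if each of its connected components is a tree. Assume that $\Delta$ is a forest with $\dim\Delta=1$. Let $R=K[x_1,\dots,x_n]$ and let $I\subset R$ be the facet ideal (edge ideal) of $\Delta$, generated by the monomials $\prod_{v_i\in F}x_i$ for all facets $F$ of $\Delta$. Let $$\operatorname{reg}(R/I)=\max\{d-i : \operatorname{Tor}^R_i(K,R/I)_d\neq 0\}$$ be the Castelnuovo–Mumford regularity, where $\operatorname{Tor}^R_i(K,R/I)_d$ is the degree $d$ part of the $i$-th homology $H_i(x_1,\dots,x_n;R/I)$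 of the Koszul complex of $R/I$. Two edges of $\Delta$ are called disconnected if they are disjoint and no edge of $\Delta$ joins a vertex of one to a vertex of the other. Then $\operatorname{reg}(R/I)$ is the maximal number $j$ for which there exist $j$ edges of $\Delta$ that are pairwise disconnected. The same holds if $I$ is replaced by the ideal generated by the monomials $x_ix_k$ for the edges $\{v_i,v_k\}$ of $\Delta$ only (the two ideals differ only if $\Delta$ has isolated vertices). -/

import Mathlib

/-! ### Simplicial complexes, trees and forests

`AbstractSimplicialComplex V` is Mathlib's notion: a downward closed family of nonempty finite sets
that contains all singletons. The empty face is left implicit. `PreAbstractSimplicialComplex V` does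
not ask for all singletons, so that it also covers subcomplexes, whose vertex set may be smaller. -/

namespace PreAbstractSimplicialComplex

/-- The set of facets, that is, of maximal faces. -/
def facets {V : Type*} (Δ : PreAbstractSimplicialComplex V) : Set (Finset V) :=
  {F | Maximal (fun G => G ∈ Δ) F}

/-- `Δ` has dimension `d`: this is the largest value of `|F| - 1` over the faces `F`. -/
def HasDimension {V : Type*} (Δ : PreAbstractSimplicialComplex V) (d : ℤ) : Prop :=
  IsGreatest {k : ℤ | ∃ F ∈ Δ, k = (F.card : ℤ) - 1} d

/-- `Γ` is a subcomplex of `Δ` in the sense that every facet of `Γ` is a facet of `Δ`. -/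
def IsFacetSubcomplex {V : Type*} (Γ Δ : PreAbstractSimplicialComplex V) : Prop :=
  Γ.facets ⊆ Δ.facets

/-- `F` is a leaf of `Δ`: it is a facet, and either it is the only facet, or there is another
facet `G` such that `F ∩ H ⊆ F ∩ G` for all facets `H ≠ F`. -/
def IsLeaf {V : Type*} [DecidableEq V] (Δ : PreAbstractSimplicialComplex V) (F : Finset V) : Prop :=
  F ∈ Δ.facets ∧
    ((∀ G ∈ Δ.facets, G = F) ∨
      ∃ G ∈ Δ.facets, G ≠ F ∧ ∀ H ∈ Δ.facets, H ≠ F → F ∩ H ⊆ F ∩ G)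

/-- Any two facets are joined by a chain of facets in which consecutive facets meet. -/
def IsConnected {V : Type*} [DecidableEq V] (Δ : PreAbstractSimplicialComplex V) : Prop :=
  ∀ F ∈ Δ.facets, ∀ G ∈ Δ.facets,
    Relation.ReflTransGen (fun A B => B ∈ Δ.facets ∧ (A ∩ B).Nonempty) F G

/-- A tree: a connected complex all of whose nonempty subcomplexes have a leaf. -/
def IsTree {V : Type*} [DecidableEq V] (Δ : PreAbstractSimplicialComplex V) : Prop :=
  Δ.IsConnected ∧
    ∀ Γ : PreAbstractSimplicialComplex V, Γ.IsFacetSubcomplex Δ → Γ.facets.Nonempty →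
      ∃ F, Γ.IsLeaf F

/-- A connected component: a maximal nonempty connected subcomplex. -/
def IsComponent {V : Type*} [DecidableEq V] (Γ Δ : PreAbstractSimplicialComplex V) : Prop :=
  Γ.IsFacetSubcomplex Δ ∧ Γ.facets.Nonempty ∧ Γ.IsConnected ∧
    ∀ Γ' : PreAbstractSimplicialComplex V, Γ'.IsFacetSubcomplex Δ → Γ'.IsConnected →
      Γ.facets ⊆ Γ'.facets → Γ'.facets = Γ.facets

/-- A forest: every connected component is a tree. -/
def IsForest {V : Type*} [DecidableEq V] (Δ : PreAbstractSimplicialComplex V) : Prop :=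
  ∀ Γ : PreAbstractSimplicialComplex V, Γ.IsComponent Δ → Γ.IsTree

/-- The edges, that is, the faces with exactly two vertices. -/
def edges {V : Type*} (Δ : PreAbstractSimplicialComplex V) : Set (Finset V) :=
  {F | F ∈ Δ ∧ F.card = 2}

/-- Two edges are disconnected if they are disjoint and no edge of `Δ` joins a vertex of the first
to a vertex of the second. -/
def Disconnected {V : Type*} [DecidableEq V] (Δ : PreAbstractSimplicialComplex V)
    (E F : Finset V) : Prop :=
  Disjoint E F ∧ ∀ u ∈ E, ∀ v ∈ F, ({u, v} : Finset V) ∉ Δ.edges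

/-- The numbers `j` for which there exist `j` edges that are pairwise disconnected. -/
def disconnectedEdgeNumbers {V : Type*} [DecidableEq V] (Δ : PreAbstractSimplicialComplex V) :
    Set ℕ :=
  {j | ∃ A : Finset (Finset V), (∀ E ∈ A, E ∈ Δ.edges) ∧
    (A : Set (Finset V)).Pairwise Δ.Disconnected ∧ A.card = j}

/-- The facet ideal, generated by the monomials `∏ v ∈ F, x_v` for the facets `F`. An isolated
vertex is a facet and contributes a variable. -/
noncomputable def facetIdeal {V : Type*} (K : Type*) [Field K]
    (Δ : PreAbstractSimplicialComplex V) : Ideal (MvPolynomial V K) :=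
  Ideal.span {f | ∃ F ∈ Δ.facets, f = ∏ v ∈ F, MvPolynomial.X v}

/-- The ideal generated by the monomials `x_u x_v` for the edges `{u, v}`; isolated vertices
contribute nothing. -/
noncomputable def edgeIdeal {V : Type*} (K : Type*) [Field K]
    (Δ : PreAbstractSimplicialComplex V) : Ideal (MvPolynomial V K) :=
  Ideal.span {f | ∃ F ∈ Δ.edges, f = ∏ v ∈ F, MvPolynomial.X v}

end PreAbstractSimplicialComplex

/-! ### Graded Koszul homology and regularity

`R` is the polynomial ring over `K` in the variables `σ`, and `I` an ideal of `R` (a homogeneous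
one in all uses). The Koszul complex of `R ⧸ I` with respect to the variables is spanned over
`R ⧸ I` by the wedge products `e_S = e_{s₁} ∧ ⋯ ∧ e_{sᵢ}` for `S = {s₁ < ⋯ < sᵢ} ⊆ σ`, and a chain
`∑ c_S e_S` is encoded as the function `S ↦ c_S`. The basis element `e_S` has homological degree
and internal degree `|S|`. -/

namespace KoszulRegularity

/-- The component of degree `k` of the standard graded ring `R ⧸ I`. -/
noncomputable def degreePart {σ K : Type*} [Field K] (I : Ideal (MvPolynomial σ K)) (k : ℕ) :
    Submodule K (MvPolynomial σ K ⧸ I) :=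
  (MvPolynomial.homogeneousSubmodule σ K k).map (Ideal.Quotient.mkₐ K I).toLinearMap

/-- The Koszul differential, `e_S ↦ ∑_{v ∈ S} (-1)^{|{u ∈ S : u < v}|} x_v e_{S \ {v}}`, written
in terms of coefficients: `e_T` arises from `e_{T ∪ {v}}` for each `v ∉ T`. -/
noncomputable def koszulD {σ K : Type*} [Fintype σ] [LinearOrder σ] [Field K]
    (I : Ideal (MvPolynomial σ K)) :
    (Finset σ → MvPolynomial σ K ⧸ I) →ₗ[K] (Finset σ → MvPolynomial σ K ⧸ I) where
  toFun c T := ∑ v ∈ Finset.univ \ T,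
    (-1) ^ (T.filter (· < v)).card * Ideal.Quotient.mk I (MvPolynomial.X v) * c (insert v T)
  map_add' c c' := by
    funext T
    simp only [Pi.add_apply, mul_add, Finset.sum_add_distrib]
  map_smul' a c := by
    funext T
    simp only [Pi.smul_apply, mul_smul_comm, Finset.smul_sum, RingHom.id_apply]

/-- The Koszul differential squares to zero, so that boundaries are cycles. -/
theorem koszulD_koszulD {σ K : Type*} [Fintype σ] [LinearOrder σ] [Field K]
    (I : Ideal (MvPolynomial σ K)) (c : Finset σ → MvPolynomial σ K ⧸ I) :
    koszulD I (koszulD I c) = 0 := by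
  funext T
  simp only [koszulD, LinearMap.coe_mk, AddHom.coe_mk, Pi.zero_apply, Finset.mul_sum]
  rw [Finset.sum_sigma']
  refine Finset.sum_involution (fun p _ => ⟨p.2, p.1⟩) ?_ ?_ ?_ ?_
  · rintro ⟨v, w⟩ h
    simp only [Finset.mem_sigma, Finset.mem_sdiff, Finset.mem_univ, Finset.mem_insert, true_and,
      not_or] at h
    obtain ⟨hv, hwv, hw⟩ := h
    dsimp only
    rw [Finset.insert_comm w v T, Finset.filter_insert, Finset.filter_insert]
    rcases lt_or_gt_of_ne hwv with h | h
    · rw [if_neg h.not_gt, if_pos h, Finset.card_insert_of_notMem (by simp [hw])]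
      ring
    · rw [if_pos h, if_neg h.not_gt, Finset.card_insert_of_notMem (by simp [hv])]
      ring
  · rintro ⟨v, w⟩ h _ heq
    simp only [Finset.mem_sigma, Finset.mem_sdiff, Finset.mem_univ, Finset.mem_insert, true_and,
      not_or] at h
    exact h.2.1 (by simpa using (congrArg Sigma.fst heq))
  · rintro ⟨v, w⟩ h
    simp only [Finset.mem_sigma, Finset.mem_sdiff, Finset.mem_univ, Finset.mem_insert, true_and,
      not_or] at h ⊢
    exact ⟨h.2.2, fun e => h.2.1 e.symm, h.1⟩
  · rintro ⟨v, w⟩ h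
    rfl

/-- The chains of homological degree `i` and internal degree `d`: combinations of the `e_S` with
`|S| = i` whose coefficients have degree `d - i`; there are none but `0` if `d < i`. -/
noncomputable def koszulChains {σ K : Type*} [Field K] (I : Ideal (MvPolynomial σ K)) (i d : ℕ) :
    Submodule K (Finset σ → MvPolynomial σ K ⧸ I) :=
  Submodule.pi Set.univ
    (fun S => if S.card = i ∧ i ≤ d then degreePart I (d - i) else ⊥)

/-- Cycles `Z_i(R ⧸ I)_d`. -/
noncomputable def koszulCycles {σ K : Type*} [Fintype σ] [LinearOrder σ] [Field K]
    (I : Ideal (MvPolynomial σ K)) (i d : ℕ) : Submodule K (Finset σ → MvPolynomial σ K ⧸ I) :=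
  koszulChains I i d ⊓ LinearMap.ker (koszulD I)

/-- Boundaries `B_i(R ⧸ I)_d`. -/
noncomputable def koszulBoundaries {σ K : Type*} [Fintype σ] [LinearOrder σ] [Field K]
    (I : Ideal (MvPolynomial σ K)) (i d : ℕ) : Submodule K (Finset σ → MvPolynomial σ K ⧸ I) :=
  (koszulChains I (i + 1) d).map (koszulD I)

/-- Koszul homology `H_i(R ⧸ I)_d = Z_i(R ⧸ I)_d / B_i(R ⧸ I)_d`. As the Koszul complex of `R` is
the minimal graded free resolution of `K`, this is `Tor_i^R(K, R ⧸ I)_d`, and its dimension is the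
graded Betti number `b_{i,d}(R ⧸ I)`. -/
abbrev KoszulHomology {σ K : Type*} [Fintype σ] [LinearOrder σ] [Field K]
    (I : Ideal (MvPolynomial σ K)) (i d : ℕ) : Type _ :=
  koszulCycles I i d ⧸ (koszulBoundaries I i d).submoduleOf (koszulCycles I i d)

/-- `R ⧸ I` has (Castelnuovo–Mumford) regularity `r`, that is,
`r = max {d - i : b_{i,d}(R ⧸ I) ≠ 0} = max {d - i : Tor_i^R(K, R ⧸ I)_d ≠ 0}`. -/
def HasRegularity {σ K : Type*} [Fintype σ] [LinearOrder σ] [Field K]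
    (I : Ideal (MvPolynomial σ K)) (r : ℤ) : Prop :=
  IsGreatest {t : ℤ | ∃ i d : ℕ, Nontrivial (KoszulHomology I i d) ∧ t = (d : ℤ) - (i : ℤ)} r

end KoszulRegularity

/-! Let `I_U` be generated by the edge monomials and the variables in `U`; both ideals of the
theorem have this form, with `U` empty or the set of isolated vertices. All work is done with
polynomial representatives of Koszul chains, modulo `I_U`. Upper bound, by induction on growing `U`:
if some edge avoids `U`, the forest hypothesis gives a vertex `a` with exactly one neighbour `b`
outside `U`. Adding `x_b` to the ideal puts `b` into `U`, and the colon ideal `I_U : x_b` puts the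
neighbours of `b` into `U`. Every pairwise disconnected family surviving in the colon ideal can be
enlarged by `{a, b}`, so its bound drops by one, which pays for the degree shift of multiplication
by `x_b` (`HomologyVanishesAbove.of_colon`). If no edge avoids `U`, every remaining variable is a
nonzerodivisor and can be added freely (`HomologyVanishesAbove.of_regular`), until `U` is
everything. Lower bound, for any graph: disconnected edges `a_k b_k` give the cycle `∏ x_{a_k} • ⋀
e_{b_k}` with coefficients of degree equal to its homological degree. A composite of operators made
of contractions and derivatives sends it to `e_∅`, boundaries to boundaries, and chains over the
ideal to chains without constant terms, so it is no boundary (`exists_detected_cycle`). -/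

namespace KoszulRegularity

open MvPolynomial

/-! ### Contraction, exterior multiplication and derivation on Koszul chains over `R` -/

section Operators

variable {σ K : Type*} [Field K]

/-- The partial derivative applied to all coefficients. -/
noncomputable def chainDeriv (v : σ) :
    (Finset σ → MvPolynomial σ K) →ₗ[K] (Finset σ → MvPolynomial σ K) where
  toFun c T := pderiv v (c T)
  map_add' c c' := by funext T; simp
  map_smul' a c := by funext T; simp

theorem chainDeriv_apply (v : σ) (c : Finset σ → MvPolynomial σ K) (T : Finset σ) :
    chainDeriv v c T = pderiv v (c T) := rfl

theorem chainDeriv_X_smul_self (v : σ) (c : Finset σ → MvPolynomial σ K) :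
    chainDeriv v ((X v : MvPolynomial σ K) • c) = c + (X v : MvPolynomial σ K) • chainDeriv v c := by
  funext T
  simp [chainDeriv_apply, add_comm]

theorem chainDeriv_X_smul_of_ne {v w : σ} (h : v ≠ w) (c : Finset σ → MvPolynomial σ K) :
    chainDeriv v ((X w : MvPolynomial σ K) • c) = (X w : MvPolynomial σ K) • chainDeriv v c := by
  funext T
  simp [chainDeriv_apply, pderiv_X_of_ne h.symm]

variable [LinearOrder σ]

/-- The sign `(-1)^{|{u ∈ T : u < v}|}`. -/
noncomputable def koszulSign (K : Type*) [Field K] (v : σ) (T : Finset σ) : MvPolynomial σ K :=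
  (-1) ^ (T.filter (· < v)).card

theorem koszulSign_insert {w : σ} {T : Finset σ} (v : σ) (hw : w ∉ T) :
    koszulSign K v (insert w T) = if w < v then -koszulSign K v T else koszulSign K v T := by
  unfold koszulSign
  rw [Finset.filter_insert]
  split_ifs
  · rw [Finset.card_insert_of_notMem (by simp [hw]), pow_succ]; ring
  · rfl

theorem koszulSign_mul_self (v : σ) (T : Finset σ) :
    koszulSign K v T * koszulSign K v T = 1 := by
  rw [koszulSign, ← mul_pow]; simp

/-- Contraction with the dual basis vector of `e_v`. -/
noncomputable def contract (v : σ) :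
    (Finset σ → MvPolynomial σ K) →ₗ[MvPolynomial σ K] (Finset σ → MvPolynomial σ K) where
  toFun c T := if v ∈ T then 0 else koszulSign K v T * c (insert v T)
  map_add' c c' := by
    funext T; by_cases h : v ∈ T <;> simp [h, mul_add]
  map_smul' a c := by
    funext T; by_cases h : v ∈ T <;> simp [h, mul_left_comm]

/-- Exterior multiplication with `e_v`. -/
noncomputable def wedge (v : σ) :
    (Finset σ → MvPolynomial σ K) →ₗ[MvPolynomial σ K] (Finset σ → MvPolynomial σ K) where
  toFun c T := if v ∈ T then koszulSign K v (T.erase v) * c (T.erase v) else 0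
  map_add' c c' := by
    funext T; by_cases h : v ∈ T <;> simp [h, mul_add]
  map_smul' a c := by
    funext T; by_cases h : v ∈ T <;> simp [h, mul_left_comm]

theorem contract_apply (v : σ) (c : Finset σ → MvPolynomial σ K) (T : Finset σ) :
    contract v c T = if v ∈ T then 0 else koszulSign K v T * c (insert v T) := rfl

theorem wedge_apply (v : σ) (c : Finset σ → MvPolynomial σ K) (T : Finset σ) :
    wedge v c T = if v ∈ T then koszulSign K v (T.erase v) * c (T.erase v) else 0 := rfl

theorem contract_contract (v w : σ) (c : Finset σ → MvPolynomial σ K) :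
    contract v (contract w c) = -contract w (contract v c) := by
  funext T
  rcases eq_or_ne v w with rfl | hvw
  · by_cases h : v ∈ T <;> simp [contract_apply, h]
  by_cases hv : v ∈ T
  · simp [contract_apply, hv]
  by_cases hw : w ∈ T
  · simp [contract_apply, hw]
  simp only [Pi.neg_apply, contract_apply, hv, hw, Finset.mem_insert, hvw, hvw.symm, or_self,
    if_false, koszulSign_insert _ hv, koszulSign_insert _ hw, Finset.insert_comm w v T]
  rcases lt_or_gt_of_ne hvw with h | h
  · rw [if_pos h, if_neg h.not_gt]; ring
  · rw [if_pos h, if_neg h.not_gt]; ring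

/-- Together with `contract_wedge_of_ne` and `contract_contract`, these are the Clifford relations
from which the homotopy formulas below follow. -/
theorem contract_wedge_self (v : σ) (c : Finset σ → MvPolynomial σ K) :
    contract v (wedge v c) = c - wedge v (contract v c) := by
  funext T
  by_cases hv : v ∈ T
  · simp [contract_apply, wedge_apply, hv, ← mul_assoc, koszulSign_mul_self]
  · simp [contract_apply, wedge_apply, hv, ← mul_assoc, koszulSign_mul_self]

theorem contract_wedge_of_ne {v w : σ} (hvw : v ≠ w) (c : Finset σ → MvPolynomial σ K) :
    contract v (wedge w c) = -wedge w (contract v c) := by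
  funext T
  by_cases hv : v ∈ T
  · by_cases hw : w ∈ T <;> simp [contract_apply, wedge_apply, hv, hw, hvw]
  by_cases hw : w ∈ T
  · obtain ⟨S, hS, rfl⟩ : ∃ S, w ∉ S ∧ insert w S = T :=
      ⟨T.erase w, by simp, Finset.insert_erase hw⟩
    have hvS : v ∉ S := fun h => hv (Finset.mem_insert_of_mem h)
    have e : (insert v (insert w S)).erase w = insert v S := by
      rw [Finset.insert_comm, Finset.erase_insert (by simp [hS, hvw.symm])]
    simp only [contract_apply, wedge_apply, Pi.neg_apply, hv, if_false, Finset.mem_insert, true_or,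
      or_true, if_true, e, Finset.erase_insert hS, hvS, koszulSign_insert _ hvS,
      koszulSign_insert _ hS]
    rcases lt_or_gt_of_ne hvw with h | h
    · rw [if_pos h, if_neg h.not_gt]; ring
    · rw [if_pos h, if_neg h.not_gt]; ring
  · simp [contract_apply, wedge_apply, hv, hw, hvw.symm]

theorem chainDeriv_contract (v w : σ) (c : Finset σ → MvPolynomial σ K) :
    chainDeriv v (contract w c) = contract w (chainDeriv v c) := by
  funext T
  have h : pderiv v (koszulSign K w T) = 0 := by
    rcases neg_one_pow_eq_or (MvPolynomial σ K) (T.filter (· < w)).card with h | h <;>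
      simp [koszulSign, h]
  by_cases hw : w ∈ T <;> simp [chainDeriv_apply, contract_apply, hw, h]

theorem chainDeriv_wedge (v w : σ) (c : Finset σ → MvPolynomial σ K) :
    chainDeriv v (wedge w c) = wedge w (chainDeriv v c) := by
  funext T
  have h : pderiv v (koszulSign K w (T.erase w)) = 0 := by
    rcases neg_one_pow_eq_or (MvPolynomial σ K) ((T.erase w).filter (· < w)).card with h | h <;>
      simp [koszulSign, h]
  by_cases hw : w ∈ T <;> simp [chainDeriv_apply, wedge_apply, hw, h]

variable [Fintype σ]

/-- The Koszul differential over the polynomial ring itself. -/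
noncomputable def polyKoszulD :
    (Finset σ → MvPolynomial σ K) →ₗ[MvPolynomial σ K] (Finset σ → MvPolynomial σ K) :=
  ∑ v, (X v : MvPolynomial σ K) • contract v

theorem polyKoszulD_eq (c : Finset σ → MvPolynomial σ K) :
    polyKoszulD c = ∑ v, (X v : MvPolynomial σ K) • contract v c := by
  simp [polyKoszulD]

theorem polyKoszulD_apply (c : Finset σ → MvPolynomial σ K) (T : Finset σ) :
    polyKoszulD c T = ∑ v, X v * contract v c T := by
  simp [polyKoszulD_eq]

theorem polyKoszulD_contract (v : σ) (c : Finset σ → MvPolynomial σ K) :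
    polyKoszulD (contract v c) = -contract v (polyKoszulD c) := by
  simp only [polyKoszulD_eq, map_sum, map_smul, contract_contract v, smul_neg,
    Finset.sum_neg_distrib, neg_neg]

/-- Exterior multiplication by `e_v` is a homotopy from multiplication by `x_v` to zero. -/
theorem polyKoszulD_wedge (v : σ) (c : Finset σ → MvPolynomial σ K) :
    polyKoszulD (wedge v c) = (X v : MvPolynomial σ K) • c - wedge v (polyKoszulD c) := by
  simp only [polyKoszulD_eq, map_sum, map_smul]
  rw [← Finset.add_sum_erase _ _ (Finset.mem_univ v),
    ← Finset.add_sum_erase Finset.univ (fun w => (X w : MvPolynomial σ K) • wedge v (contract w c))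
      (Finset.mem_univ v), contract_wedge_self,
    Finset.sum_congr rfl fun w hw => by rw [contract_wedge_of_ne (Finset.ne_of_mem_erase hw)]]
  simp only [smul_neg, Finset.sum_neg_distrib, smul_sub]
  abel

/-- The Leibniz rule: only the summand `x_v ι_v` of the differential has a coefficient that `∂/∂x_v`
does not kill. -/
theorem chainDeriv_polyKoszulD (v : σ) (c : Finset σ → MvPolynomial σ K) :
    chainDeriv v (polyKoszulD c) = contract v c + polyKoszulD (chainDeriv v c) := by
  simp only [polyKoszulD_eq, map_sum]
  rw [← Finset.add_sum_erase _ _ (Finset.mem_univ v),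
    ← Finset.add_sum_erase Finset.univ
      (fun w => (X w : MvPolynomial σ K) • contract w (chainDeriv v c)) (Finset.mem_univ v),
    chainDeriv_X_smul_self, chainDeriv_contract,
    Finset.sum_congr rfl fun w hw => by
      rw [chainDeriv_X_smul_of_ne (Finset.ne_of_mem_erase hw).symm, chainDeriv_contract]]
  abel

theorem koszulD_mk (I : Ideal (MvPolynomial σ K)) (c : Finset σ → MvPolynomial σ K) :
    koszulD I (fun S => Ideal.Quotient.mk I (c S)) =
      fun T => Ideal.Quotient.mk I (polyKoszulD c T) := by
  funext T
  rw [polyKoszulD_apply, map_sum]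
  simp only [koszulD, LinearMap.coe_mk, AddHom.coe_mk]
  rw [← Finset.sum_sdiff (Finset.subset_univ T),
    Finset.sum_eq_zero (s := T) (fun v hv => by simp [contract_apply, hv]), add_zero]
  refine Finset.sum_congr rfl fun v hv => ?_
  rw [contract_apply, if_neg (Finset.mem_sdiff.1 hv).2]
  simp only [koszulSign, map_mul, map_pow, map_neg, map_one]
  ring

theorem polyKoszulD_polyKoszulD (c : Finset σ → MvPolynomial σ K) :
    polyKoszulD (polyKoszulD c) = 0 := by
  funext T
  have h := congrFun (koszulD_koszulD ⊥ fun S => Ideal.Quotient.mk ⊥ (c S)) T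
  rw [koszulD_mk, koszulD_mk] at h
  exact Ideal.mem_bot.1 (Ideal.Quotient.eq_zero_iff_mem.1 h)

end Operators

end KoszulRegularity

namespace KoszulRegularity

open MvPolynomial

/-! ### Homogeneous chains and vanishing of Koszul homology -/

section Homogeneous

variable {σ K : Type*} [Field K]

/-- `c` is a combination of the `e_S` with `|S| = i` whose coefficients are forms of degree `k`. -/
def IsKoszulChain (i k : ℕ) (c : Finset σ → MvPolynomial σ K) : Prop :=
  ∀ S, if S.card = i then (c S).IsHomogeneous k else c S = 0

theorem IsKoszulChain.isHomogeneous {i k : ℕ} {c : Finset σ → MvPolynomial σ K}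
    (hc : IsKoszulChain i k c) (S : Finset σ) : (c S).IsHomogeneous k := by
  have h := hc S
  split_ifs at h
  · exact h
  · rw [h]; exact isHomogeneous_zero _ _ _

theorem IsKoszulChain.add {i k : ℕ} {c c' : Finset σ → MvPolynomial σ K}
    (hc : IsKoszulChain i k c) (hc' : IsKoszulChain i k c') : IsKoszulChain i k (c + c') := by
  intro S
  have h := hc S
  have h' := hc' S
  split_ifs at h h' ⊢
  · exact h.add h'
  · simp [h, h']

theorem IsKoszulChain.sum {ι : Type*} {s : Finset ι} {i k : ℕ}
    {c : ι → Finset σ → MvPolynomial σ K} (hc : ∀ j ∈ s, IsKoszulChain i k (c j)) :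
    IsKoszulChain i k (∑ j ∈ s, c j) := by
  refine Finset.sum_induction _ _ (fun _ _ => IsKoszulChain.add) (fun S => ?_) hc
  split_ifs
  · exact isHomogeneous_zero _ _ _
  · rfl

theorem IsKoszulChain.X_smul {i k : ℕ} {c : Finset σ → MvPolynomial σ K}
    (hc : IsKoszulChain i k c) (v : σ) :
    IsKoszulChain i (k + 1) ((X v : MvPolynomial σ K) • c) := by
  intro S
  have h := hc S
  split_ifs at h ⊢
  · rw [add_comm]; exact (isHomogeneous_X K v).mul h
  · simp [h]

theorem homogeneousComponent_X_mul (x : σ) (k : ℕ) (f : MvPolynomial σ K) :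
    homogeneousComponent (k + 1) (X x * f) = X x * homogeneousComponent k f := by
  classical
  ext m
  rw [coeff_homogeneousComponent, coeff_X_mul', coeff_X_mul', coeff_homogeneousComponent]
  by_cases hx : x ∈ m.support
  · have h : m.degree = (m - Finsupp.single x 1).degree + 1 := by
      have : m - Finsupp.single x 1 + Finsupp.single x 1 = m :=
        tsub_add_cancel_of_le (by
          rw [Finsupp.single_le_iff]; exact Nat.one_le_iff_ne_zero.2 (Finsupp.mem_support_iff.1 hx))
      conv_lhs => rw [← this]
      simp
    simp [hx, h]
  · simp [hx]

/-- As `I` is homogeneous, the cofactor of `x` may be replaced by its component of degree `k`. -/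
theorem exists_isKoszulChain_X_smul {I : Ideal (MvPolynomial σ K)} {x : σ} {i k : ℕ}
    (hI : ∀ f ∈ I, ∀ d, homogeneousComponent d f ∈ I) {c : Finset σ → MvPolynomial σ K}
    (hc : IsKoszulChain i (k + 1) c) (h : ∀ S, c S ∈ I ⊔ Ideal.span {X x}) :
    ∃ y, IsKoszulChain i k y ∧ ∀ S, c S - X x * y S ∈ I := by
  have key : ∀ S, ∃ g : MvPolynomial σ K, g.IsHomogeneous k ∧ c S - X x * g ∈ I := by
    intro S
    obtain ⟨f, hf, g, hg, hfg⟩ := Submodule.mem_sup.1 (h S)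
    obtain ⟨g, rfl⟩ := Ideal.mem_span_singleton.1 hg
    refine ⟨homogeneousComponent k g, homogeneousComponent_isHomogeneous _ _, ?_⟩
    have h1 := homogeneousComponent_of_mem (m := k + 1) (hc.isHomogeneous S)
    rw [if_pos rfl, ← hfg, map_add, homogeneousComponent_X_mul] at h1
    rw [← hfg, ← h1, add_sub_cancel_right]
    exact hI f hf _
  choose g hg hg' using key
  refine ⟨fun S => if S.card = i then g S else 0, fun S => ?_, fun S => ?_⟩
  · by_cases hS : S.card = i
    · simp only [hS, if_true]; exact hg S
    · simp [hS]
  · by_cases hS : S.card = i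
    · simpa only [hS, if_true] using hg' S
    · have := hc S
      rw [if_neg hS] at this
      simp [hS, this]

theorem mk_mem_koszulChains {I : Ideal (MvPolynomial σ K)} {i k : ℕ}
    {c : Finset σ → MvPolynomial σ K} (hc : IsKoszulChain i k c) :
    (fun S => Ideal.Quotient.mk I (c S)) ∈ koszulChains I i (i + k) := by
  rw [koszulChains, Submodule.mem_pi]
  intro S _
  have h := hc S
  by_cases hS : S.card = i
  · rw [if_pos hS] at h
    rw [if_pos ⟨hS, by omega⟩, Nat.add_sub_cancel_left]
    exact ⟨c S, h, rfl⟩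
  · rw [if_neg hS] at h
    simp [h]

theorem exists_isKoszulChain_of_mem {I : Ideal (MvPolynomial σ K)} {i k : ℕ}
    {c : Finset σ → MvPolynomial σ K ⧸ I} (hc : c ∈ koszulChains I i (i + k)) :
    ∃ c', IsKoszulChain i k c' ∧ c = fun S => Ideal.Quotient.mk I (c' S) := by
  rw [koszulChains, Submodule.mem_pi] at hc
  have key : ∀ S : Finset σ, ∃ f : MvPolynomial σ K,
      (if S.card = i then f.IsHomogeneous k else f = 0) ∧ Ideal.Quotient.mk I f = c S := by
    intro S
    have h := hc S trivial
    by_cases hS : S.card = i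
    · rw [if_pos ⟨hS, by omega⟩, Nat.add_sub_cancel_left] at h
      obtain ⟨f, hf, hfc⟩ := h
      exact ⟨f, by rw [if_pos hS]; exact hf, hfc⟩
    · rw [if_neg fun h => hS h.1, Submodule.mem_bot] at h
      exact ⟨0, by simp [hS], by simp [h]⟩
  choose f hf hfc using key
  exact ⟨f, hf, funext fun S => (hfc S).symm⟩

variable [LinearOrder σ]

theorem isHomogeneous_koszulSign (v : σ) (T : Finset σ) : (koszulSign K v T).IsHomogeneous 0 := by
  rcases neg_one_pow_eq_or (MvPolynomial σ K) (T.filter (· < v)).card with h | h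
  · rw [koszulSign, h]; exact isHomogeneous_one σ K
  · rw [koszulSign, h]; exact (isHomogeneous_one σ K).neg

theorem IsKoszulChain.contract {i k : ℕ} {c : Finset σ → MvPolynomial σ K}
    (hc : IsKoszulChain (i + 1) k c) (v : σ) : IsKoszulChain i k (contract v c) := by
  intro S
  rw [contract_apply]
  by_cases hv : v ∈ S
  · simp [hv, isHomogeneous_zero]
  · have h := hc (insert v S)
    rw [Finset.card_insert_of_notMem hv] at h
    simp only [add_left_inj] at h
    rw [if_neg hv]
    split_ifs at h ⊢
    · simpa using (isHomogeneous_koszulSign v S).mul h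
    · simp [h]

theorem IsKoszulChain.wedge {i k : ℕ} {c : Finset σ → MvPolynomial σ K}
    (hc : IsKoszulChain i k c) (v : σ) : IsKoszulChain (i + 1) k (wedge v c) := by
  intro S
  rw [wedge_apply]
  by_cases hv : v ∈ S
  · have h := hc (S.erase v)
    rw [if_pos hv, ← Finset.card_erase_add_one hv]
    simp only [add_left_inj]
    split_ifs at h ⊢
    · simpa using (isHomogeneous_koszulSign v _).mul h
    · simp [h]
  · simp [hv, isHomogeneous_zero]

variable [Fintype σ]

theorem IsKoszulChain.polyKoszulD {i k : ℕ} {c : Finset σ → MvPolynomial σ K}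
    (hc : IsKoszulChain (i + 1) k c) : IsKoszulChain i (k + 1) (polyKoszulD c) := by
  rw [polyKoszulD_eq]
  exact IsKoszulChain.sum fun v _ => (hc.contract v).X_smul v

/-! ### Vanishing above a given degree and its transfer between ideals -/

/-- The homology `H_i(R ⧸ I)_d` vanishes for all `d > i + r`. -/
def HomologyVanishesAbove (I : Ideal (MvPolynomial σ K)) (r : ℕ) : Prop :=
  ∀ i k : ℕ, r ≤ k → ∀ c : Finset σ → MvPolynomial σ K, IsKoszulChain i (k + 1) c →
    (∀ T, KoszulRegularity.polyKoszulD c T ∈ I) →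
    ∃ w, IsKoszulChain (i + 1) k w ∧ ∀ S, c S - KoszulRegularity.polyKoszulD w S ∈ I

/-- A chase through `R/J(-1) → R/I → R/L`: modulo `L` the cycle `c` bounds, so `c - dw ≡ x y` modulo
`I`; applying `d` gives `x dy ∈ I`, hence `dy ∈ J`. Only one inclusion of the colon ideal is needed,
so `J = I` is allowed when `x` is regular. -/
theorem exists_reduction {I J L : Ideal (MvPolynomial σ K)} {x : σ} {r i k : ℕ}
    (hI : ∀ f ∈ I, ∀ d, homogeneousComponent d f ∈ I) (hJ : ∀ f, X x * f ∈ I → f ∈ J)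
    (hL : L = I ⊔ Ideal.span {X x}) (hr : HomologyVanishesAbove L r) (hk : r ≤ k)
    {c : Finset σ → MvPolynomial σ K} (hc : IsKoszulChain i (k + 1) c)
    (hcI : ∀ T, polyKoszulD c T ∈ I) :
    ∃ w y, IsKoszulChain (i + 1) k w ∧ IsKoszulChain i k y ∧
      (∀ S, c S - polyKoszulD w S - X x * y S ∈ I) ∧ ∀ T, polyKoszulD y T ∈ J := by
  obtain ⟨w, hw, hcw⟩ := hr i k hk c hc fun T => hL ▸ Ideal.mem_sup_left (hcI T)
  have hc' : IsKoszulChain i (k + 1) (c - polyKoszulD w) := by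
    have h2 := (hw.polyKoszulD)
    intro S
    have h := hc S
    have h' := h2 S
    split_ifs at h h' ⊢
    · exact h.sub h'
    · simp [h, h']
  obtain ⟨y, hy, hyI⟩ := exists_isKoszulChain_X_smul (x := x) hI hc' fun S => hL ▸ hcw S
  refine ⟨w, y, hw, hy, hyI, fun T => hJ _ ?_⟩
  have h1 : polyKoszulD (c - polyKoszulD w - (X x : MvPolynomial σ K) • y) T ∈ I := by
    rw [polyKoszulD_apply]
    refine Ideal.sum_mem _ fun v _ => Ideal.mul_mem_left _ _ ?_
    rw [contract_apply]
    split_ifs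
    · exact zero_mem _
    · exact Ideal.mul_mem_left _ _ (hyI _)
  rw [map_sub, map_sub, polyKoszulD_polyKoszulD, map_smul, sub_zero] at h1
  simpa using sub_mem (hcI T) h1

/-- Vanishing passes from `I : x` (with a shift) and `I + (x)` to `I`. -/
theorem HomologyVanishesAbove.of_colon {I J L : Ideal (MvPolynomial σ K)} {x : σ} {r : ℕ}
    (hI : ∀ f ∈ I, ∀ d, homogeneousComponent d f ∈ I) (hJ : ∀ f, X x * f ∈ I ↔ f ∈ J)
    (hL : L = I ⊔ Ideal.span {X x}) (hLr : HomologyVanishesAbove L (r + 1))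
    (hJr : HomologyVanishesAbove J r) : HomologyVanishesAbove I (r + 1) := by
  intro i k hk c hc hcI
  obtain ⟨k, rfl⟩ := Nat.exists_eq_add_of_le' (Nat.le_of_add_left_le hk : 1 ≤ k)
  obtain ⟨w, y, hw, hy, hcy, hyJ⟩ := exists_reduction hI (fun f => (hJ f).1) hL hLr hk hc hcI
  obtain ⟨u, hu, hyu⟩ := hJr i k (by omega) y hy hyJ
  -- Since `y - du` has coefficients in `J`, the chain `x y - d(x u)` has coefficients in `I`.
  refine ⟨w + (X x : MvPolynomial σ K) • u, hw.add (hu.X_smul x), fun S => ?_⟩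
  have h := add_mem (hcy S) ((hJ _).2 (hyu S))
  convert h using 1
  simp only [map_add, map_smul, Pi.add_apply, Pi.smul_apply, smul_eq_mul]
  ring

/-- If `x` is a nonzerodivisor on `R ⧸ I`, then vanishing passes from `I + (x)` to `I`, as `x`
acts as zero on Koszul homology. -/
theorem HomologyVanishesAbove.of_regular {I L : Ideal (MvPolynomial σ K)} {x : σ} {r : ℕ}
    (hI : ∀ f ∈ I, ∀ d, homogeneousComponent d f ∈ I) (hx : ∀ f, X x * f ∈ I → f ∈ I)
    (hL : L = I ⊔ Ideal.span {X x}) (hLr : HomologyVanishesAbove L r) :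
    HomologyVanishesAbove I r := by
  intro i k hk c hc hcI
  obtain ⟨w, y, hw, hy, hcy, hyI⟩ := exists_reduction hI hx hL hLr hk hc hcI
  -- By the homotopy formula `x y = d(e_x ∧ y) + e_x ∧ dy`, and the last term vanishes modulo `I`.
  refine ⟨w + wedge x y, hw.add (hy.wedge x), fun S => ?_⟩
  have h1 : wedge x (polyKoszulD y) S ∈ I := by
    rw [wedge_apply]
    split_ifs
    · exact Ideal.mul_mem_left _ _ (hyI _)
    · exact zero_mem _
  convert add_mem (hcy S) h1 using 1
  simp only [map_add, polyKoszulD_wedge, Pi.add_apply, Pi.sub_apply, Pi.smul_apply, smul_eq_mul]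
  ring

/-! ### Comparison with Koszul homology of the quotient -/

theorem nontrivial_koszulHomology_iff {I : Ideal (MvPolynomial σ K)} {i d : ℕ} :
    Nontrivial (KoszulHomology I i d) ↔ ¬ koszulCycles I i d ≤ koszulBoundaries I i d := by
  rw [Submodule.Quotient.nontrivial_iff, Submodule.submoduleOf, ne_eq,
    Submodule.comap_subtype_eq_top]

theorem HomologyVanishesAbove.le_of_nontrivial {I : Ideal (MvPolynomial σ K)} {r i d : ℕ}
    (hr : HomologyVanishesAbove I r) (h : Nontrivial (KoszulHomology I i d)) : d ≤ i + r := by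
  rw [nontrivial_koszulHomology_iff] at h
  by_contra! hd
  obtain ⟨k, rfl⟩ := Nat.exists_eq_add_of_le (show i + 1 ≤ d by omega)
  refine h fun c hc => ?_
  obtain ⟨hc, hcker⟩ := Submodule.mem_inf.1 hc
  rw [add_assoc, add_comm 1 k] at hc
  obtain ⟨c, hc', rfl⟩ := exists_isKoszulChain_of_mem hc
  rw [LinearMap.mem_ker, koszulD_mk] at hcker
  obtain ⟨w, hw, hcw⟩ := hr i k (by omega) c hc' fun T =>
    Ideal.Quotient.eq_zero_iff_mem.1 (congrFun hcker T)
  refine ⟨_, mk_mem_koszulChains hw, ?_⟩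
  rw [koszulD_mk]
  funext S
  exact (Ideal.Quotient.eq.2 (hcw S)).symm

theorem nontrivial_koszulHomology {I : Ideal (MvPolynomial σ K)} {i k : ℕ}
    {z : Finset σ → MvPolynomial σ K} (hz : IsKoszulChain i k z) (hzI : ∀ T, polyKoszulD z T ∈ I)
    (h : ∀ w, ¬ ∀ S, z S - polyKoszulD w S ∈ I) :
    Nontrivial (KoszulHomology I i (i + k)) := by
  rw [nontrivial_koszulHomology_iff]
  intro hle
  obtain ⟨w, -, hw⟩ := hle (show (fun S => Ideal.Quotient.mk I (z S)) ∈ koszulCycles I i (i + k) from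
    ⟨mk_mem_koszulChains hz, by
      rw [SetLike.mem_coe, LinearMap.mem_ker, koszulD_mk]
      exact funext fun T => Ideal.Quotient.eq_zero_iff_mem.2 (hzI T)⟩)
  choose w' hw' using fun S => Ideal.Quotient.mk_surjective (w S)
  obtain rfl : (fun S => Ideal.Quotient.mk I (w' S)) = w := funext hw'
  rw [koszulD_mk] at hw
  exact h w' fun S => Ideal.Quotient.eq.1 (congrFun hw S).symm

end Homogeneous

end KoszulRegularity

namespace KoszulRegularity

open MvPolynomial

/-! ### Ideals generated by the edges of a graph and a set of variables -/

section GraphIdeal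

variable {σ K : Type*} [Field K] {G : SimpleGraph σ} {U : Set σ}

/-- The ideal generated by the `x_u x_v` for the edges `uv` of `G` and the `x_u` for `u ∈ U`. -/
noncomputable def graphIdeal (K : Type*) [Field K] (G : SimpleGraph σ) (U : Set σ) :
    Ideal (MvPolynomial σ K) :=
  Ideal.span ((fun s => monomial s (1 : K)) '' {s | (∃ u ∈ U, s = Finsupp.single u 1) ∨
    ∃ u v, G.Adj u v ∧ s = Finsupp.single u 1 + Finsupp.single v 1})

/-- The monomial with exponent `s` lies in `graphIdeal K G U`. -/
def IsNonfaceExponent (G : SimpleGraph σ) (U : Set σ) (s : σ →₀ ℕ) : Prop :=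
  (∃ u ∈ U, s u ≠ 0) ∨ ∃ u v, G.Adj u v ∧ s u ≠ 0 ∧ s v ≠ 0

/-- Membership in a monomial ideal is tested on monomials. Looplessness makes the edge generators
squarefree, so divisibility depends only on the support of the exponent. -/
theorem mem_graphIdeal {f : MvPolynomial σ K} :
    f ∈ graphIdeal K G U ↔ ∀ s, coeff s f ≠ 0 → IsNonfaceExponent G U s := by
  classical
  rw [graphIdeal, mem_ideal_span_monomial_image]
  refine forall_congr' fun s => ?_
  rw [mem_support_iff]
  refine imp_congr_right fun _ => ⟨?_, ?_⟩
  · rintro ⟨t, ⟨u, hu, rfl⟩ | ⟨u, v, huv, rfl⟩, hts⟩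
    · exact .inl ⟨u, hu, by have := hts u; simp at this; omega⟩
    · have h1 := hts u
      have h2 := hts v
      simp [huv.ne, huv.ne.symm] at h1 h2
      exact .inr ⟨u, v, huv, by omega, by omega⟩
  · rintro (⟨u, hu, hs⟩ | ⟨u, v, huv, hu, hv⟩)
    · exact ⟨_, .inl ⟨u, hu, rfl⟩, by rw [Finsupp.single_le_iff]; omega⟩
    · refine ⟨_, .inr ⟨u, v, huv, rfl⟩, fun w => ?_⟩
      have := huv.ne
      simp only [Finsupp.add_apply, Finsupp.single_apply]
      split_ifs with h1 h2 h2
      · exact absurd (h1.trans h2.symm) this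
      · subst h1; omega
      · subst h2; omega
      · omega

theorem homogeneousComponent_mem_graphIdeal {f : MvPolynomial σ K} (hf : f ∈ graphIdeal K G U)
    (d : ℕ) : homogeneousComponent d f ∈ graphIdeal K G U := by
  rw [mem_graphIdeal] at hf ⊢
  intro s hs
  rw [coeff_homogeneousComponent] at hs
  split_ifs at hs
  · exact hf s hs
  · exact absurd rfl hs

theorem constantCoeff_eq_zero_of_mem_graphIdeal {f : MvPolynomial σ K}
    (hf : f ∈ graphIdeal K G U) : constantCoeff f = 0 := by
  rw [mem_graphIdeal] at hf
  by_contra h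
  rcases hf 0 h with ⟨_, _, h⟩ | ⟨_, _, _, h, _⟩ <;> exact h rfl

/-- The combinatorial form of the colon ideal by `x`: an edge through `x` then only requires its
other end. -/
theorem isNonfaceExponent_add_single_iff {x : σ} (hx : x ∉ U) (s : σ →₀ ℕ) :
    IsNonfaceExponent G U (s + Finsupp.single x 1) ↔
      IsNonfaceExponent G (U ∪ G.neighborSet x) s := by
  classical
  have key : ∀ w, (s + Finsupp.single x 1 : σ →₀ ℕ) w ≠ 0 ↔ s w ≠ 0 ∨ x = w := by
    intro w
    by_cases h : x = w <;> simp [h]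
  simp only [IsNonfaceExponent, key]
  constructor
  · rintro (⟨u, hu, h | rfl⟩ | ⟨u, v, huv, hu | rfl, hv | rfl⟩)
    · exact .inl ⟨u, .inl hu, h⟩
    · exact absurd hu hx
    · exact .inr ⟨u, v, huv, hu, hv⟩
    · exact .inl ⟨u, .inr huv.symm, hu⟩
    · exact .inl ⟨v, .inr huv, hv⟩
    · exact absurd huv (G.irrefl)
  · rintro (⟨u, hu | hu, h⟩ | ⟨u, v, huv, hu, hv⟩)
    · exact .inl ⟨u, hu, .inl h⟩
    · exact .inr ⟨x, u, hu, .inr rfl, .inl h⟩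
    · exact .inr ⟨u, v, huv, .inl hu, .inl hv⟩

theorem X_mul_mem_graphIdeal_iff {x : σ} (hx : x ∉ U) (f : MvPolynomial σ K) :
    X x * f ∈ graphIdeal K G U ↔ f ∈ graphIdeal K G (U ∪ G.neighborSet x) := by
  classical
  rw [mem_graphIdeal, mem_graphIdeal]
  constructor
  · intro h s hs
    rw [← isNonfaceExponent_add_single_iff hx]
    refine h _ ?_
    rwa [add_comm, coeff_X_mul]
  · intro h s hs
    rw [coeff_X_mul'] at hs
    split_ifs at hs with hxs
    · have := h _ hs
      rw [← isNonfaceExponent_add_single_iff hx, tsub_add_cancel_of_le] at this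
      · exact this
      · rw [Finsupp.single_le_iff]
        exact Nat.one_le_iff_ne_zero.2 (Finsupp.mem_support_iff.1 hxs)
    · exact absurd rfl hs

/-- The coefficient of the derivative at `s` is a multiple of that of `f` at `s + e_x`, so the
derivative lands in the colon ideal by `x`, in any characteristic. -/
theorem pderiv_mem_graphIdeal {x : σ} (hx : x ∉ U) {f : MvPolynomial σ K}
    (hf : f ∈ graphIdeal K G U) : pderiv x f ∈ graphIdeal K G (U ∪ G.neighborSet x) := by
  rw [mem_graphIdeal] at hf ⊢
  intro s hs
  rw [coeff_pderiv] at hs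
  rw [← isNonfaceExponent_add_single_iff hx]
  exact hf _ (left_ne_zero_of_mul hs)

theorem graphIdeal_mono {U' : Set σ} (h : U ⊆ U') : graphIdeal K G U ≤ graphIdeal K G U' :=
  Ideal.span_mono (Set.image_mono fun _ hs => hs.imp_left fun ⟨u, hu, e⟩ => ⟨u, h hu, e⟩)

theorem graphIdeal_insert (x : σ) :
    graphIdeal K G (insert x U) = graphIdeal K G U ⊔ Ideal.span {X x} := by
  rw [graphIdeal, graphIdeal, ← Ideal.span_union]
  congr 1
  ext f
  simp only [Set.mem_image, Set.mem_ofPred_eq, Set.mem_union, Set.mem_singleton_iff,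
    Set.mem_insert_iff]
  constructor
  · rintro ⟨s, ⟨u, rfl | hu, rfl⟩ | h, rfl⟩
    · exact .inr rfl
    · exact .inl ⟨_, .inl ⟨u, hu, rfl⟩, rfl⟩
    · exact .inl ⟨_, .inr h, rfl⟩
  · rintro (⟨s, ⟨u, hu, rfl⟩ | h, rfl⟩ | rfl)
    · exact ⟨_, .inl ⟨u, .inr hu, rfl⟩, rfl⟩
    · exact ⟨_, .inr h, rfl⟩
    · exact ⟨_, .inl ⟨x, .inl rfl, rfl⟩, rfl⟩

/-- The maximal ideal has regularity zero. -/
theorem homologyVanishesAbove_univ [LinearOrder σ] [Fintype σ] (r : ℕ) :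
    HomologyVanishesAbove (graphIdeal K G Set.univ) r := by
  intro i k _ c hc _
  -- The coefficients have degree `k + 1 > 0`, so they already lie in the maximal ideal.
  refine ⟨0, fun S => by split_ifs <;> simp [isHomogeneous_zero], fun S => ?_⟩
  rw [map_zero, Pi.zero_apply, sub_zero, mem_graphIdeal]
  intro s hs
  have h := (hc.isHomogeneous S) hs
  by_contra h'
  have : s = 0 := by
    ext u
    by_contra hu
    exact h' (.inl ⟨u, trivial, hu⟩)
  simp [this] at h

end GraphIdeal

end KoszulRegularity

namespace PreAbstractSimplicialComplex

/-! ### Leaves in forests -/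

section Forest

variable {V : Type*} [DecidableEq V]

/-- The complex generated by a family of nonempty sets. -/
def generate (S : Set (Finset V)) : PreAbstractSimplicialComplex V where
  faces := {F | F.Nonempty ∧ ∃ G ∈ S, F ⊆ G}
  isRelLowerSet_faces := by
    rintro F ⟨hF, G, hG, hFG⟩
    exact ⟨hF, fun F' h hF' => ⟨hF', G, hG, h.trans hFG⟩⟩

-- Facets of `Δ` are pairwise incomparable, so any set of them is the full facet set of the complex
-- it generates.
omit [DecidableEq V] in
theorem facets_generate {Δ : PreAbstractSimplicialComplex V} {S : Set (Finset V)}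
    (hS : S ⊆ Δ.facets) : (generate S).facets = S := by
  have hne : ∀ F ∈ S, F.Nonempty := fun F hF => (Δ.isRelLowerSet_faces (hS hF).1).1
  ext F
  constructor
  · rintro ⟨⟨hF, G, hG, hFG⟩, hmax⟩
    have := hmax (y := G) ⟨hne G hG, G, hG, subset_rfl⟩ hFG
    rwa [subset_antisymm hFG this]
  · intro hF
    refine ⟨⟨hne F hF, F, hF, subset_rfl⟩, ?_⟩
    rintro F' ⟨hF', G, hG, hFG⟩ hFF'
    exact hFG.trans ((hS hF).2 (hS hG).1 (hFF'.trans hFG))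

/-- In a forest, every nonempty set of facets contains a leaf of the complex it generates. -/
theorem IsForest.exists_isLeaf {Δ : PreAbstractSimplicialComplex V} (h : Δ.IsForest)
    {A : Set (Finset V)} (hA : A ⊆ Δ.facets) (hne : A.Nonempty) :
    ∃ F ∈ A, (∀ G ∈ A, G ≠ F → Disjoint F G) ∨
      ∃ G ∈ A, G ≠ F ∧ ∀ H ∈ A, H ≠ F → F ∩ H ⊆ F ∩ G := by
  obtain ⟨F₀, hF₀⟩ := hne
  let r : Set (Finset V) → Finset V → Finset V → Prop := fun S A B => B ∈ S ∧ (A ∩ B).Nonempty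
  let S : Set (Finset V) := {F | F ∈ Δ.facets ∧ Relation.ReflTransGen (r Δ.facets) F₀ F}
  have hS : S ⊆ Δ.facets := fun F hF => hF.1
  have hF₀S : F₀ ∈ S := ⟨hA hF₀, .refl⟩
  -- Chains starting at `F₀` stay inside its component `S` and can be reversed there.
  have hfwd : ∀ F, Relation.ReflTransGen (r Δ.facets) F₀ F →
      F ∈ S ∧ Relation.ReflTransGen (r S) F₀ F ∧ Relation.ReflTransGen (r S) F F₀ := by
    intro F hF
    induction hF with
    | refl => exact ⟨hF₀S, .refl, .refl⟩
    | tail hab hbc ih =>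
      have hc : _ ∈ S := ⟨hbc.1, hab.tail hbc⟩
      exact ⟨hc, ih.2.1.tail ⟨hc, hbc.2⟩,
        .head ⟨ih.1, by rw [Finset.inter_comm]; exact hbc.2⟩ ih.2.2⟩
  have hfac := facets_generate hS
  have hcomp : (generate S).IsComponent Δ := by
    refine ⟨by rw [IsFacetSubcomplex, hfac]; exact hS, by rw [hfac]; exact ⟨F₀, hF₀S⟩, ?_, ?_⟩
    · intro F hF G hG
      rw [hfac] at hF hG ⊢
      exact (hfwd F hF.2).2.2.trans (hfwd G hG.2).2.1
    · intro Γ hΓ hconn hle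
      rw [hfac] at hle ⊢
      refine subset_antisymm (fun G hG => ⟨hΓ hG, ?_⟩) hle
      have hr : r Γ.facets ≤ r Δ.facets := fun _ _ hab => ⟨hΓ hab.1, hab.2⟩
      exact Relation.ReflTransGen.mono hr _ _ (hconn F₀ (hle hF₀S) G hG)
  have hfac' : (generate (A ∩ S)).facets = A ∩ S :=
    facets_generate (Set.inter_subset_left.trans hA)
  obtain ⟨F, hF, hleaf⟩ := (h _ hcomp).2 (generate (A ∩ S))
    (by rw [IsFacetSubcomplex, hfac', hfac]; exact Set.inter_subset_right)
    (by rw [hfac']; exact ⟨F₀, hF₀, hF₀S⟩)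
  rw [hfac'] at hF hleaf
  -- The leaf is found in `A ∩ S` only; facets of `A` in other components cannot meet it.
  have hdisj : ∀ H ∈ A, H ∉ S → F ∩ H = ∅ := by
    intro H hH hHS
    by_contra hFH
    exact hHS ⟨hA hH, hF.2.2.tail ⟨hA hH, Finset.nonempty_iff_ne_empty.2 hFH⟩⟩
  refine ⟨F, hF.1, ?_⟩
  rcases hleaf with hleaf | ⟨G, hG, hGF, hleaf⟩
  · left
    intro G hG hGF
    exact Finset.disjoint_iff_inter_eq_empty.2 (hdisj G hG fun hGS => hGF (hleaf G ⟨hG, hGS⟩))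
  · right
    refine ⟨G, hG.1, hGF, fun H hH hHF => ?_⟩
    by_cases hHS : H ∈ S
    · exact hleaf H ⟨hH, hHS⟩ hHF
    · simp [hdisj H hH hHS]

/-! ### One-dimensional complexes and their graphs -/

omit [DecidableEq V] in
theorem HasDimension.card_le {Δ : PreAbstractSimplicialComplex V} (h : Δ.HasDimension 1)
    {F : Finset V} (hF : F ∈ Δ) : F.card ≤ 2 := by
  have := h.2 ⟨F, hF, rfl⟩
  omega

omit [DecidableEq V] in
theorem HasDimension.edges_subset_facets {Δ : PreAbstractSimplicialComplex V}
    (h : Δ.HasDimension 1) : Δ.edges ⊆ Δ.facets :=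
  fun F hF => ⟨hF.1, fun G hG hFG =>
    (Finset.eq_of_subset_of_card_le hFG (by rw [hF.2]; exact h.card_le hG)).ge⟩

/-- The graph of the edges of a complex. -/
def edgeGraph (Δ : PreAbstractSimplicialComplex V) : SimpleGraph V where
  Adj u v := {u, v} ∈ Δ.edges
  symm := ⟨fun u v h => by rwa [Finset.pair_comm]⟩
  loopless := ⟨fun u h => by simpa using h.2⟩

theorem exists_adj_of_mem_edges {Δ : PreAbstractSimplicialComplex V} {E : Finset V}
    (hE : E ∈ Δ.edges) : ∃ a b, Δ.edgeGraph.Adj a b ∧ E = {a, b} := by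
  obtain ⟨a, b, -, rfl⟩ := Finset.card_eq_two.1 hE.2
  exact ⟨a, b, hE, rfl⟩

/-- In a one-dimensional forest, every induced subgraph with an edge has a vertex of degree one. -/
theorem IsForest.exists_degree_one {Δ : PreAbstractSimplicialComplex V} (h : Δ.IsForest)
    (hdim : Δ.HasDimension 1) {U : Set V}
    (hU : ∃ a b, Δ.edgeGraph.Adj a b ∧ a ∉ U ∧ b ∉ U) :
    ∃ a b, Δ.edgeGraph.Adj a b ∧ a ∉ U ∧ b ∉ U ∧
      ∀ c ∉ U, Δ.edgeGraph.Adj a c → c = b := by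
  obtain ⟨a₀, b₀, hab₀, ha₀, hb₀⟩ := hU
  obtain ⟨F, ⟨hF, hFU⟩, hleaf⟩ := h.exists_isLeaf
    (A := {E | E ∈ Δ.edges ∧ ∀ v ∈ E, v ∉ U}) (fun E hE => hdim.edges_subset_facets hE.1)
    ⟨{a₀, b₀}, hab₀, by simp [ha₀, hb₀]⟩
  -- Two distinct edges `F` and `G` leave a vertex of `F` outside `G`; every other edge meets `F`
  -- only within `G`, so it misses that vertex.
  have key : ∃ a ∈ F, ∀ H, H ∈ Δ.edges → (∀ v ∈ H, v ∉ U) → H ≠ F → a ∉ H := by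
    rcases hleaf with hleaf | ⟨G, hG, hGF, hleaf⟩
    · obtain ⟨a, b, -, rfl⟩ := exists_adj_of_mem_edges hF
      exact ⟨a, by simp, fun H hH hHU hHF =>
        Finset.disjoint_left.1 (hleaf H ⟨hH, hHU⟩ hHF) (by simp)⟩
    · obtain ⟨a, ha, haG⟩ : ∃ a ∈ F, a ∉ G := by
        by_contra! hsub
        exact hGF (Finset.eq_of_subset_of_card_le hsub (by rw [hF.2, hG.1.2])).symm
      exact ⟨a, ha, fun H hH hHU hHF haH =>
        haG (Finset.mem_inter.1 (hleaf H ⟨hH, hHU⟩ hHF (Finset.mem_inter.2 ⟨ha, haH⟩))).2⟩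
  obtain ⟨a, ha, hkey⟩ := key
  obtain ⟨b, rfl⟩ : ∃ b, F = {a, b} := by
    obtain ⟨x, y, -, rfl⟩ := exists_adj_of_mem_edges hF
    rcases Finset.mem_insert.1 ha with rfl | ha
    · exact ⟨y, rfl⟩
    · rw [Finset.mem_singleton.1 ha]
      exact ⟨x, Finset.pair_comm _ _⟩
  refine ⟨a, b, hF, hFU a (by simp), hFU b (by simp), fun c hc hac => ?_⟩
  by_contra hcb
  refine hkey {a, c} hac (by simpa using ⟨hFU a (by simp), hc⟩) (fun e => ?_) (by simp)
  have : c ∈ ({a, b} : Finset V) := e ▸ (by simp)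
  rcases Finset.mem_insert.1 this with rfl | h
  · exact hac.ne rfl
  · exact hcb (Finset.mem_singleton.1 h)

end Forest

end PreAbstractSimplicialComplex

namespace PreAbstractSimplicialComplex

open MvPolynomial KoszulRegularity

section Regularity

variable {σ K : Type*} [LinearOrder σ] [Fintype σ] [Field K]

/-! ### The upper bound -/

theorem IsForest.homologyVanishesAbove {Δ : PreAbstractSimplicialComplex σ} (h : Δ.IsForest)
    (hdim : Δ.HasDimension 1) (U : Set σ) :
    ∀ r : ℕ, (∀ A : Finset (Finset σ), (∀ E ∈ A, E ∈ Δ.edges ∧ ∀ v ∈ E, v ∉ U) →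
      (A : Set (Finset σ)).Pairwise Δ.Disconnected → A.card ≤ r) →
    HomologyVanishesAbove (graphIdeal K Δ.edgeGraph U) r := by
  induction U using WellFoundedGT.induction with
  | ind U ih =>
  intro r hr
  by_cases hU : ∃ a b, Δ.edgeGraph.Adj a b ∧ a ∉ U ∧ b ∉ U
  · obtain ⟨a, b, hab, ha, hb, hleaf⟩ := h.exists_degree_one hdim hU
    have hrpos : 1 ≤ r := by
      have := hr {{a, b}} (by
        intro E hE
        rw [Finset.mem_singleton.1 hE]
        exact ⟨hab, by simp [ha, hb]⟩) (by simp)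
      simpa using this
    obtain ⟨r, rfl⟩ := Nat.exists_eq_add_of_le' hrpos
    -- The colon is taken at `b`, not at the degree-one vertex `a`: this removes all neighbours of
    -- `b`, including `a`, so surviving edges are disconnected from `{a, b}`.
    refine HomologyVanishesAbove.of_colon (x := b)
      (J := graphIdeal K Δ.edgeGraph (U ∪ Δ.edgeGraph.neighborSet b))
      (fun f hf d => homogeneousComponent_mem_graphIdeal hf d) (X_mul_mem_graphIdeal_iff hb)
      (graphIdeal_insert b) (ih _ (Set.ssubset_insert hb) _ fun A hA => hr A fun E hE =>
        ⟨(hA E hE).1, fun v hv hvU => (hA E hE).2 v hv (.inr hvU)⟩)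
      (ih _ ?_ _ fun A hA hdisc => ?_)
    · refine Set.ssubset_iff_subset_ne.2 ⟨Set.subset_union_left, fun e => ha ?_⟩
      rw [e]
      exact .inr hab.symm
    · have haA : ∀ E ∈ A, a ∉ E := fun E hE haE => (hA E hE).2 a haE (.inr hab.symm)
      -- Although `b` itself need not be removed, an edge through it has its other end in the
      -- neighbourhood of `b`.
      have hbA : ∀ E ∈ A, b ∉ E := by
        intro E hE hbE
        obtain ⟨c, d, hcd, rfl⟩ := exists_adj_of_mem_edges (hA E hE).1
        rcases Finset.mem_insert.1 hbE with rfl | hbd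
        · exact (hA _ hE).2 d (by simp) (.inr hcd)
        · rw [Finset.mem_singleton.1 hbd] at hA
          exact (hA _ (Finset.mem_singleton.1 hbd ▸ hE)).2 c (by simp) (.inr hcd.symm)
      have hnew : ∀ E ∈ A, Δ.Disconnected {a, b} E := by
        refine fun E hE => ⟨?_, fun u hu v hv huv => ?_⟩
        · simp [haA E hE, hbA E hE]
        · rcases Finset.mem_insert.1 hu with rfl | hu
          · refine hbA E hE ?_
            rwa [← hleaf v (fun hvU => (hA E hE).2 v hv (.inl hvU)) huv]
          · rw [Finset.mem_singleton.1 hu] at huv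
            exact (hA E hE).2 v hv (.inr huv)
      have hmem : ({a, b} : Finset σ) ∉ A := fun hE => haA _ hE (by simp)
      have := hr (insert {a, b} A) (by
          intro E hE
          rcases Finset.mem_insert.1 hE with rfl | hE
          · exact ⟨hab, by simp [ha, hb]⟩
          · exact ⟨(hA E hE).1, fun v hv hvU => (hA E hE).2 v hv (.inl hvU)⟩) (by
          rw [Finset.coe_insert]
          refine hdisc.insert fun E hE _ => ⟨hnew E hE, (hnew E hE).1.symm, fun u hu v hv huv => ?_⟩
          exact (hnew E hE).2 v hv u hu (by rwa [Finset.pair_comm]))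
      rw [Finset.card_insert_of_notMem hmem] at this
      omega
  · push Not at hU
    by_cases hx : ∃ x, x ∉ U
    · obtain ⟨x, hx⟩ := hx
      refine HomologyVanishesAbove.of_regular (x := x)
        (fun f hf d => homogeneousComponent_mem_graphIdeal hf d) (fun f hf => ?_)
        (graphIdeal_insert x) (ih _ (Set.ssubset_insert hx) _ fun A hA => hr A fun E hE =>
          ⟨(hA E hE).1, fun v hv hvU => (hA E hE).2 v hv (.inr hvU)⟩)
      -- All neighbours of `x` lie in `U`, so the colon ideal by `x` is the ideal itself.
      rw [X_mul_mem_graphIdeal_iff hx, Set.union_eq_self_of_subset_right] at hf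
      · exact hf
      · exact fun y hy => hU x y hy hx
    · push Not at hx
      rw [Set.eq_univ_of_forall hx]
      exact homologyVanishesAbove_univ r

/-! ### The lower bound -/

/-- `D = ι_a ∘ ∂/∂x_b + ι_b ∘ ∂/∂x_a`, an operator that anticommutes with the differential. -/
noncomputable def edgeOperator (a b : σ) :
    (Finset σ → MvPolynomial σ K) →ₗ[K] (Finset σ → MvPolynomial σ K) :=
  (contract a).restrictScalars K ∘ₗ chainDeriv b + (contract b).restrictScalars K ∘ₗ chainDeriv a

omit [Fintype σ] in
theorem edgeOperator_apply (a b : σ) (c : Finset σ → MvPolynomial σ K) :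
    edgeOperator a b c = contract a (chainDeriv b c) + contract b (chainDeriv a c) := rfl

/-- Moving `∂/∂x_b` and `∂/∂x_a` past `d` leaves the extra terms `ι_a ι_b` and `ι_b ι_a`, which
cancel; this is why both summands of the operator are needed. -/
theorem edgeOperator_polyKoszulD (a b : σ) (c : Finset σ → MvPolynomial σ K) :
    edgeOperator a b (polyKoszulD c) = polyKoszulD (-edgeOperator a b c) := by
  simp only [edgeOperator_apply, chainDeriv_polyKoszulD, map_add, map_neg, polyKoszulD_contract,
    contract_contract a b]
  abel

-- The derivative in `x_a` removes the factor `x_a` with coefficient one and `ι_b` strips `e_b`, so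
-- no division occurs.
omit [Fintype σ] in
theorem edgeOperator_X_smul_wedge {a b : σ} (hab : a ≠ b) {z : Finset σ → MvPolynomial σ K}
    (ha : chainDeriv a z = 0) (hb : chainDeriv b z = 0) (hb' : contract b z = 0) :
    edgeOperator a b ((X a : MvPolynomial σ K) • wedge b z) = z := by
  rw [edgeOperator_apply, chainDeriv_X_smul_of_ne hab.symm, chainDeriv_X_smul_self,
    chainDeriv_wedge, chainDeriv_wedge, ha, hb]
  simp [contract_wedge_self, hb']

omit [Fintype σ] in
theorem edgeOperator_mem_graphIdeal {G : SimpleGraph σ} {U : Set σ} {a b : σ} (ha : a ∉ U)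
    (hb : b ∉ U) {f : Finset σ → MvPolynomial σ K} (hf : ∀ S, f S ∈ graphIdeal K G U)
    (S : Finset σ) :
    edgeOperator a b f S ∈ graphIdeal K G (U ∪ (G.neighborSet a ∪ G.neighborSet b)) := by
  have key : ∀ x y : σ, x ∉ U → G.neighborSet x ⊆ G.neighborSet a ∪ G.neighborSet b →
      contract y (chainDeriv x f) S ∈
        graphIdeal K G (U ∪ (G.neighborSet a ∪ G.neighborSet b)) := by
    intro x y hx hsub
    rw [contract_apply]
    split_ifs
    · exact zero_mem _
    · exact Ideal.mul_mem_left _ _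
        (graphIdeal_mono (Set.union_subset_union_right _ hsub) (pderiv_mem_graphIdeal hx (hf _)))
  exact add_mem (key b a hb Set.subset_union_right) (key a b ha Set.subset_union_left)

/-- Pairwise disconnected edges `a_k b_k` give the chain `z = ∏ x_{a_k} • ⋀ e_{b_k}`, a cycle modulo
the edge ideal, and a linear map `Ψ` that detects it. -/
theorem exists_detected_cycle {Δ : PreAbstractSimplicialComplex σ} (A : Finset (Finset σ))
    (hA : ∀ E ∈ A, E ∈ Δ.edges) (hdisc : (A : Set (Finset σ)).Pairwise Δ.Disconnected) :
    ∃ (z : Finset σ → MvPolynomial σ K)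
      (Ψ : (Finset σ → MvPolynomial σ K) →ₗ[K] (Finset σ → MvPolynomial σ K)),
      IsKoszulChain A.card A.card z ∧
      (∀ v, (∀ E ∈ A, v ∉ E) → chainDeriv v z = 0 ∧ contract v z = 0) ∧
      (∀ U T, polyKoszulD z T ∈ graphIdeal K Δ.edgeGraph U) ∧
      constantCoeff (Ψ z ∅) = 1 ∧
      (∀ w, ∃ w', Ψ (polyKoszulD w) = polyKoszulD w') ∧
      ∀ U : Set σ, (∀ E ∈ A, ∀ v ∈ E, v ∉ U) → ∀ f : Finset σ → MvPolynomial σ K,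
        (∀ S, f S ∈ graphIdeal K Δ.edgeGraph U) → ∀ S, constantCoeff (Ψ f S) = 0 := by
  induction A using Finset.induction_on with
  | empty =>
    have hcontract : ∀ v : σ,
        contract v (Pi.single ∅ 1 : Finset σ → MvPolynomial σ K) = 0 := by
      intro v
      funext T
      simp [contract_apply]
    refine ⟨Pi.single ∅ 1, LinearMap.id, fun S => ?_, fun v _ => ⟨?_, hcontract v⟩, fun U T => ?_,
      by simp, fun w => ⟨w, rfl⟩, fun U _ f hf S => constantCoeff_eq_zero_of_mem_graphIdeal (hf S)⟩
    · by_cases hS : S = ∅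
      · simp [hS, isHomogeneous_one]
      · simp [hS]
    · funext T
      by_cases hT : T = ∅
      · subst hT; simp [chainDeriv_apply]
      · simp [chainDeriv_apply, hT]
    · simp [polyKoszulD_eq, hcontract]
  | insert E A hE ih =>
    obtain ⟨z, Ψ, hz, hzv, hzI, hz1, hΨ, hΨI⟩ := ih
      (fun F hF => hA F (Finset.mem_insert_of_mem hF))
      (hdisc.mono (by rw [Finset.coe_insert]; exact Set.subset_insert _ _))
    obtain ⟨a, b, hab, rfl⟩ := exists_adj_of_mem_edges (hA E (Finset.mem_insert_self _ _))
    have hnew : ∀ F ∈ A, Δ.Disconnected {a, b} F := fun F hF =>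
      hdisc (by simp) (by simp [hF]) (by rintro rfl; exact hE hF)
    have haA : ∀ F ∈ A, a ∉ F := fun F hF => Finset.disjoint_left.1 (hnew F hF).1 (by simp)
    have hbA : ∀ F ∈ A, b ∉ F := fun F hF => Finset.disjoint_left.1 (hnew F hF).1 (by simp)
    -- The operator of the new edge acts first and undoes the new factor `x_a e_b`, leaving the old
    -- cycle to `Ψ`.
    refine ⟨(X a : MvPolynomial σ K) • wedge b z, Ψ ∘ₗ edgeOperator a b, ?_, fun v hv => ?_,
      fun U T => ?_, ?_, fun w => ?_, fun U hU f hf S => ?_⟩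
    · rw [Finset.card_insert_of_notMem hE]
      exact (hz.wedge b).X_smul a
    · have hva : v ≠ a := fun e => hv _ (Finset.mem_insert_self _ _) (by simp [e])
      have hvb : v ≠ b := fun e => hv _ (Finset.mem_insert_self _ _) (by simp [e])
      obtain ⟨h1, h2⟩ := hzv v fun F hF => hv F (Finset.mem_insert_of_mem hF)
      rw [chainDeriv_X_smul_of_ne hva, chainDeriv_wedge, map_smul, contract_wedge_of_ne hvb, h1, h2]
      simp
    -- The differential is `x_a x_b z - x_a e_b ∧ dz`: the first term contains an edge monomial, the
    -- second is covered by induction.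
    · rw [map_smul, polyKoszulD_wedge, smul_sub, smul_smul, Pi.sub_apply]
      refine sub_mem (Ideal.mul_mem_right _ _ ?_) (Ideal.mul_mem_left _ _ ?_)
      · exact Ideal.subset_span ⟨_, .inr ⟨a, b, hab, rfl⟩, by simp [X, monomial_mul]⟩
      · rw [wedge_apply]
        split_ifs
        · exact Ideal.mul_mem_left _ _ (hzI U _)
        · exact zero_mem _
    · rw [LinearMap.comp_apply, edgeOperator_X_smul_wedge hab.ne (hzv a haA).1 (hzv b hbA).1
        (hzv b hbA).2, hz1]
    · obtain ⟨w', hw'⟩ := hΨ (-edgeOperator a b w)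
      exact ⟨w', by rw [LinearMap.comp_apply, edgeOperator_polyKoszulD, hw']⟩
    -- The operator enlarges `U` by the neighbours of `a` and `b`; disconnectedness keeps the
    -- remaining edges outside.
    · refine hΨI (U ∪ (Δ.edgeGraph.neighborSet a ∪ Δ.edgeGraph.neighborSet b))
        (fun F hF v hv hvU => ?_) _ (edgeOperator_mem_graphIdeal
          (hU _ (Finset.mem_insert_self _ _) a (by simp))
          (hU _ (Finset.mem_insert_self _ _) b (by simp)) hf) S
      rcases hvU with hvU | hva | hvb
      · exact hU F (Finset.mem_insert_of_mem hF) v hv hvU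
      · exact (hnew F hF).2 a (by simp) v hv hva
      · exact (hnew F hF).2 b (by simp) v hv hvb

theorem nontrivial_koszulHomology_graphIdeal {Δ : PreAbstractSimplicialComplex σ}
    {A : Finset (Finset σ)} {U : Set σ} (hA : ∀ E ∈ A, E ∈ Δ.edges)
    (hdisc : (A : Set (Finset σ)).Pairwise Δ.Disconnected) (hU : ∀ E ∈ A, ∀ v ∈ E, v ∉ U) :
    Nontrivial (KoszulHomology (graphIdeal K Δ.edgeGraph U) A.card (A.card + A.card)) := by
  obtain ⟨z, Ψ, hz, -, hzI, hz1, hΨ, hΨI⟩ := exists_detected_cycle (K := K) A hA hdisc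
  refine nontrivial_koszulHomology hz (hzI U) fun w hw => ?_
  obtain ⟨w', hw'⟩ := hΨ w
  -- At `∅` the constant term of `Ψ z` is one, while a boundary has none because each summand
  -- carries a variable.
  have h := hΨI U hU (z - polyKoszulD w) hw ∅
  rw [map_sub, hw', Pi.sub_apply, map_sub, hz1, polyKoszulD_apply] at h
  simp at h

theorem IsForest.hasRegularity_graphIdeal {Δ : PreAbstractSimplicialComplex σ} (h : Δ.IsForest)
    (hdim : Δ.HasDimension 1) {U : Set σ} (hU : ∀ E ∈ Δ.edges, ∀ v ∈ E, v ∉ U) {j : ℕ}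
    (hj : IsGreatest Δ.disconnectedEdgeNumbers j) :
    HasRegularity (graphIdeal K Δ.edgeGraph U) (j : ℤ) := by
  obtain ⟨⟨A, hA, hdisc, rfl⟩, hmax⟩ := hj
  refine ⟨⟨A.card, A.card + A.card, nontrivial_koszulHomology_graphIdeal hA hdisc
    fun E hE => hU E (hA E hE), by push_cast; ring⟩, ?_⟩
  rintro t ⟨i, d, hid, rfl⟩
  have := (h.homologyVanishesAbove (K := K) hdim U A.card fun B hB hBdisc =>
    hmax ⟨B, fun E hE => (hB E hE).1, hBdisc, rfl⟩).le_of_nontrivial hid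
  omega

end Regularity

/-! ### Edge ideal and facet ideal -/

section Ideals

variable {V : Type*} [DecidableEq V]

theorem edgeIdeal_eq_graphIdeal (K : Type*) [Field K] (Δ : PreAbstractSimplicialComplex V) :
    Δ.edgeIdeal K = graphIdeal K Δ.edgeGraph ∅ := by
  rw [edgeIdeal, graphIdeal]
  congr 1
  ext f
  constructor
  · rintro ⟨F, hF, rfl⟩
    obtain ⟨a, b, hab, rfl⟩ := exists_adj_of_mem_edges hF
    exact ⟨_, .inr ⟨a, b, hab, rfl⟩, by simp [Finset.prod_pair hab.ne, X, monomial_mul]⟩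
  · rintro ⟨s, ⟨u, hu, -⟩ | ⟨a, b, hab, rfl⟩, rfl⟩
    · exact hu.elim
    · exact ⟨{a, b}, hab, by simp [Finset.prod_pair hab.ne, X, monomial_mul]⟩

theorem facetIdeal_eq_graphIdeal (K : Type*) [Field K] {Δ : PreAbstractSimplicialComplex V}
    (hdim : Δ.HasDimension 1) :
    Δ.facetIdeal K = graphIdeal K Δ.edgeGraph {v | {v} ∈ Δ.facets} := by
  rw [facetIdeal, graphIdeal]
  congr 1
  ext f
  constructor
  · rintro ⟨F, hF, rfl⟩
    have hpos : 0 < F.card := (Δ.isRelLowerSet_faces hF.1).1.card_pos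
    have hle := hdim.card_le hF.1
    obtain h1 | h2 : F.card = 1 ∨ F.card = 2 := by omega
    · obtain ⟨v, rfl⟩ := Finset.card_eq_one.1 h1
      exact ⟨_, .inl ⟨v, hF, rfl⟩, by simp [X]⟩
    · obtain ⟨a, b, hab, rfl⟩ := exists_adj_of_mem_edges ⟨hF.1, h2⟩
      exact ⟨_, .inr ⟨a, b, hab, rfl⟩, by simp [Finset.prod_pair hab.ne, X, monomial_mul]⟩
  · rintro ⟨s, ⟨u, hu, rfl⟩ | ⟨a, b, hab, rfl⟩, rfl⟩
    · exact ⟨{u}, hu, by simp [X]⟩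
    · exact ⟨{a, b}, hdim.edges_subset_facets hab,
        by simp [Finset.prod_pair hab.ne, X, monomial_mul]⟩

omit [DecidableEq V] in
theorem singleton_notMem_facets_of_mem_edge {Δ : PreAbstractSimplicialComplex V} {E : Finset V}
    (hE : E ∈ Δ.edges) {v : V} (hv : v ∈ E) : {v} ∉ Δ.facets := by
  intro h
  have := Finset.card_le_card (h.2 hE.1 (Finset.singleton_subset_iff.2 hv))
  rw [hE.2, Finset.card_singleton] at this
  omega

theorem exists_isGreatest_disconnectedEdgeNumbers [Fintype V]
    (Δ : PreAbstractSimplicialComplex V) : ∃ j, IsGreatest Δ.disconnectedEdgeNumbers j := by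
  refine ⟨_, Nat.sSup_mem (s := Δ.disconnectedEdgeNumbers) ⟨0, ∅, by simp, by simp, rfl⟩ ?_,
    fun j hj => le_csSup ?_ hj⟩
  all_goals
    refine ⟨Fintype.card (Finset V), ?_⟩
    rintro _ ⟨A, -, -, rfl⟩
    exact A.card_le_univ

end Ideals

end PreAbstractSimplicialComplex

theorem theorem2p16 {K : Type*} [Field K] (n : ℕ) (Δ : AbstractSimplicialComplex (Fin n))
    (hdim : Δ.HasDimension 1) (hforest : Δ.IsForest) :
    ∃ j : ℕ, IsGreatest Δ.disconnectedEdgeNumbers j ∧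
      KoszulRegularity.HasRegularity (Δ.facetIdeal K) (j : ℤ) ∧
      KoszulRegularity.HasRegularity (Δ.edgeIdeal K) (j : ℤ) := by
  obtain ⟨j, hj⟩ := Δ.exists_isGreatest_disconnectedEdgeNumbers
  refine ⟨j, hj, ?_, ?_⟩
  · rw [PreAbstractSimplicialComplex.facetIdeal_eq_graphIdeal K hdim]
    exact hforest.hasRegularity_graphIdeal hdim (fun E hE v hv =>
      PreAbstractSimplicialComplex.singleton_notMem_facets_of_mem_edge hE hv) hj
  · rw [PreAbstractSimplicialComplex.edgeIdeal_eq_graphIdeal]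
    exact hforest.hasRegularity_graphIdeal hdim (fun _ _ _ _ => Set.notMem_empty _) hj
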